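/- Let $d\ge 2$, let $\mathcal M_d$ be the complex $d\times d$ matrices and let $\{|i\rangle\}_{i=1}^d$ be an orthonormal basis of $\mathbb C^d$. Write $\mathcal T_d$ for the set of quantum channels (completely positive, trace-preserving linear maps) $\mathcal M_d\to\mathcal M_d$, and $\mathcal E_d$ for the set of POVMs $M=(M_1,\dots,M_d)$ on $\mathbb C^d$, i.e. $M_i\in\mathcal M_d$ positive semidefinite with $\sum_i M_i=\mathbb 1$. Let $\Delta:\mathcal T_d\to[0,\infty]$ satisfy: (1a) $\Delta(\mathrm{id})=0$; (1b) $\Delta$ is convex; (1c) $\Delta\big(U\Phi(U^*\cdot U)U^*\big)=\Delta(\Phi)$ for every unitary $U\in\mathcal M_d$ and every $\Phi\in\mathcal T_d$. Let $\delta:\mathcal E_d\to[0,\infty]$ satisfy: (2a) $\delta\big((|i\rangle\langle i|)_{i=1}^d\big)=0$; (2b) $\delta$ is convex; (2c) $\delta\big((U_\pi^*M_{\pi(i)}U_\pi)_{i=1}^d\big)=\delta(M)$ for every permutation $\pi$ and every $M\in\mathcal E_d$, where $U_\pi|i\rangle=|\pi(i)\rangle$; (2d) $\delta\big((D^*M_iD)_{i=1}^d\big)=\delta(M)$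 for every unitary $D$ that is diagonal in the basis $\{|i\rangle\}$ and every $M\in\mathcal E_d$. A measurement device is described by a quantum channel $T:\mathcal M_d\to\mathcal M_d\otimes\mathcal M_d$. Its marginals $T_1,T_2\in\mathcal T_d$ are obtained by tracing out the second, respectively the first, tensor factor of the output; its disturbance is $\Delta(T_1)$ and its measurement error is $\delta(E'_T)$, where $E'_T:=\big(T_2^*(|i\rangle\langle i|)\big)_{i=1}^d$ and $T_2^*$ is the dual map, $\operatorname{tr}(T_2^*(A)\rho)=\operatorname{tr}(A\,T_2(\rho))$. Let $\mathcal F$ be the two-parameter family of all maps $$T(\rho)=\sum_{i=1}^d\Big[z\,\langle i|\rho|i\rangle\,\frac{\mathbb 1-|i\rangle\langle i|}{d-1}+(1-z)K_i\rho K_i\Big]\otimes|i\rangle\langle i|,\qquad K_i=\mu\mathbb 1+\nu|i\rangle\langle i|,$$ with $z\in[0,1]$ and $\mu,\nu\in\mathbb R$ such that $T$ is trace preserving. Theorem. Every member of $\mathcal F$ is a quantum channel, and the optimal $\Delta$–$\delta$ tradeoff is attained within $\mathcal F$: for every quantum channel $T:\mathcal M_d\to\mathcal M_d\otimes\mathcal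 M_d$ there is a $T'\in\mathcal F$ with $$\Delta(T'_1)\le\Delta(T_1)\qquad\text{and}\qquad\delta(E'_{T'})\le\delta(E'_T).$$ -/

import Mathlib

open scoped ComplexOrder Kronecker NNReal ENNReal

noncomputable section

namespace InfoDisturbance

/-- The algebra `M_ι` of complex matrices indexed by `ι`. The algebra `M_d` is `Mat (Fin d)`, and
`M_d ⊗ M_d` is `Mat (Fin d × Fin d)`, the tensor product of matrices being the Kronecker product. -/
abbrev Mat (ι : Type) : Type := Matrix ι ι ℂ

section Maps

variable {ι κ : Type} [Fintype ι] [DecidableEq ι] [Fintype κ]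

/-- `(id_n ⊗ Φ)(X)`: the map `Φ` is applied to every block of the `n × n` block matrix `X`. -/
def ampliation (n : ℕ) (Φ : Mat ι →ₗ[ℂ] Mat κ) (X : Mat (Fin n × ι)) : Mat (Fin n × κ) :=
  Matrix.of fun p q => Φ (Matrix.of fun a b => X (p.1, a) (q.1, b)) p.2 q.2

/-- Complete positivity: every `id_n ⊗ Φ` maps positive semidefinite matrices to positive
semidefinite matrices. -/
def IsCompletelyPositive (Φ : Mat ι →ₗ[ℂ] Mat κ) : Prop :=
  ∀ (n : ℕ) (X : Mat (Fin n × ι)), X.PosSemidef → (ampliation n Φ X).PosSemidef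

def IsTracePreserving (Φ : Mat ι →ₗ[ℂ] Mat κ) : Prop :=
  ∀ ρ : Mat ι, (Φ ρ).trace = ρ.trace

/-- The set of quantum channels from `M_ι` to `M_κ`. -/
def channels (ι κ : Type) [Fintype ι] [Fintype κ] :
    Set (Mat ι →ₗ[ℂ] Mat κ) :=
  {Φ | IsCompletelyPositive Φ ∧ IsTracePreserving Φ}

/-- The conjugation `ρ ↦ A ρ A*`. -/
def conjMap (A : Mat ι) : Mat ι →ₗ[ℂ] Mat ι where
  toFun ρ := A * ρ * A.conjTranspose
  map_add' x y := by rw [mul_add, add_mul]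
  map_smul' c x := by simp

/-- The dual `Φ*` of `Φ` (Heisenberg picture), given by `tr (Φ*(A) ρ) = tr (A Φ(ρ))` for all `ρ`;
its entry `(k, l)` is therefore `tr (A Φ(|l⟩⟨k|))`. -/
def dualMap (Φ : Mat ι →ₗ[ℂ] Mat κ) (A : Mat κ) : Mat ι :=
  Matrix.of fun k l => (A * Φ (Matrix.single l k 1)).trace

theorem trace_dualMap_mul (Φ : Mat ι →ₗ[ℂ] Mat κ) (A : Mat κ) (ρ : Mat ι) :
    (dualMap Φ A * ρ).trace = (A * Φ ρ).trace := by
  conv_rhs => rw [Matrix.matrix_eq_sum_single ρ]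
  have h : ∀ i j, Matrix.single i j (ρ i j) = ρ i j • Matrix.single i j (1 : ℂ) := by
    intro i j; simp
  simp only [h, map_sum, map_smul, Matrix.mul_sum, Matrix.trace_sum, Matrix.mul_smul,
    Matrix.trace_smul, smul_eq_mul]
  rw [Finset.sum_comm]
  simp [Matrix.trace, Matrix.mul_apply, dualMap, mul_comm]

/-- The partial trace over the second tensor factor. -/
def traceSnd : Mat (ι × κ) →ₗ[ℂ] Mat ι where
  toFun X := Matrix.of fun a b => ∑ c, X (a, c) (b, c)
  map_add' x y := by ext; simp [Finset.sum_add_distrib]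
  map_smul' c x := by ext; simp [Finset.mul_sum]

/-- The partial trace over the first tensor factor. -/
def traceFst : Mat (ι × κ) →ₗ[ℂ] Mat κ where
  toFun X := Matrix.of fun a b => ∑ c, X (c, a) (c, b)
  map_add' x y := by ext; simp [Finset.sum_add_distrib]
  map_smul' c x := by ext; simp [Finset.mul_sum]

end Maps

/-- The POVMs with `d` outcomes on `ℂ^d`. -/
def povms (d : ℕ) : Set (Fin d → Mat (Fin d)) :=
  {M | (∀ i, (M i).PosSemidef) ∧ ∑ i, M i = 1}

/-- Orthonormal bases of `ℂ^d`. -/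
abbrev ONB (d : ℕ) : Type := OrthonormalBasis (Fin d) ℂ (EuclideanSpace ℂ (Fin d))

variable {d : ℕ}

/-- The operator `|i⟩⟨j|` of the basis `b`. -/
def ketBra (b : ONB d) (i j : Fin d) : Mat (Fin d) :=
  Matrix.vecMulVec (b i).ofLp (star (b j).ofLp)

/-- The matrix element `⟨i|ρ|i⟩` in the basis `b`. -/
def diagEntry (b : ONB d) (i : Fin d) (ρ : Mat (Fin d)) : ℂ :=
  star (b i).ofLp ⬝ᵥ (ρ.mulVec (b i).ofLp)

/-- The unitary `U_π` of a permutation `π`, with `U_π |i⟩ = |π(i)⟩`. -/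
def permUnitary (b : ONB d) (π : Equiv.Perm (Fin d)) : Mat (Fin d) :=
  ∑ i, ketBra b (π i) i

/-- The matrix that is diagonal in the basis `b` with diagonal entries `c i`; it is unitary if and
only if all `c i` have modulus one. -/
def diagonalIn (b : ONB d) (c : Fin d → ℂ) : Mat (Fin d) :=
  ∑ i, c i • ketBra b i i

/-- The assumption on a measure `Δ : T_d → [0, ∞]` of disturbance; only the values of `Δ` on
channels matter. -/
structure IsDisturbanceMeasure (Δ : (Mat (Fin d) →ₗ[ℂ] Mat (Fin d)) → ℝ≥0∞) : Prop where
  id_eq_zero : Δ LinearMap.id = 0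
  convex : ConvexOn ℝ≥0 (channels (Fin d) (Fin d)) Δ
  basis_independent : ∀ U ∈ Matrix.unitaryGroup (Fin d) ℂ, ∀ Φ ∈ channels (Fin d) (Fin d),
    Δ (conjMap U ∘ₗ Φ ∘ₗ conjMap U.conjTranspose) = Δ Φ

/-- The assumption on a measure `δ : E_d → [0, ∞]` of the error with respect to the von Neumann
measurement in the basis `b`; only the values of `δ` on POVMs matter. -/
structure IsErrorMeasure (b : ONB d) (δ : (Fin d → Mat (Fin d)) → ℝ≥0∞) : Prop where
  target_eq_zero : δ (fun i => ketBra b i i) = 0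
  convex : ConvexOn ℝ≥0 (povms d) δ
  perm_invariant : ∀ π : Equiv.Perm (Fin d), ∀ M ∈ povms d,
    δ (fun i => (permUnitary b π).conjTranspose * M (π i) * permUnitary b π) = δ M
  diagonal_invariant : ∀ c : Fin d → ℂ, (∀ i, ‖c i‖ = 1) → ∀ M ∈ povms d,
    δ (fun i => (diagonalIn b c).conjTranspose * M i * diagonalIn b c) = δ M

/-- The marginal `T_1` of `T : M_d → M_d ⊗ M_d`: the evolution of the disturbed system. -/
def marginalFst (T : Mat (Fin d) →ₗ[ℂ] Mat (Fin d × Fin d)) : Mat (Fin d) →ₗ[ℂ] Mat (Fin d) :=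
  traceSnd ∘ₗ T

/-- The marginal `T_2` of `T : M_d → M_d ⊗ M_d`, whose output is measured in the basis `b`. -/
def marginalSnd (T : Mat (Fin d) →ₗ[ℂ] Mat (Fin d × Fin d)) : Mat (Fin d) →ₗ[ℂ] Mat (Fin d) :=
  traceFst ∘ₗ T

/-- The approximate measurement `E'_i = T_2*(|i⟩⟨i|)` performed by `T`. -/
def measuredPOVM (b : ONB d) (T : Mat (Fin d) →ₗ[ℂ] Mat (Fin d × Fin d)) : Fin d → Mat (Fin d) :=
  fun i => dualMap (marginalSnd T) (ketBra b i i)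

/-- `K_i = μ 1 + ν |i⟩⟨i|`. -/
def krausOp (b : ONB d) (μ ν : ℝ) (i : Fin d) : Mat (Fin d) :=
  (μ : ℂ) • (1 : Mat (Fin d)) + (ν : ℂ) • ketBra b i i

/-- The map
`T(ρ) = ∑ i, [z ⟨i|ρ|i⟩ (1 - |i⟩⟨i|) / (d - 1) + (1 - z) K_i ρ K_i] ⊗ |i⟩⟨i|`. -/
def device (b : ONB d) (z μ ν : ℝ) : Mat (Fin d) →ₗ[ℂ] Mat (Fin d × Fin d) where
  toFun ρ := ∑ i,
    (((z : ℂ) * diagEntry b i ρ / ((d : ℂ) - 1)) • (1 - ketBra b i i)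
      + (1 - (z : ℂ)) • (krausOp b μ ν i * ρ * krausOp b μ ν i)) ⊗ₖ ketBra b i i
  map_add' x y := by
    rw [← Finset.sum_add_distrib]
    refine Finset.sum_congr rfl fun i _ => ?_
    rw [← Matrix.add_kronecker]
    congr 1
    simp only [diagEntry, Matrix.add_mulVec, dotProduct_add, mul_add, add_mul, add_div, add_smul,
      smul_add]
    abel
  map_smul' c x := by
    simp only [RingHom.id_apply, Finset.smul_sum]
    refine Finset.sum_congr rfl fun i _ => ?_
    rw [← Matrix.smul_kronecker]
    congr 1
    simp only [diagEntry, Matrix.smul_mulVec, dotProduct_smul, Matrix.mul_smul, Matrix.smul_mul,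
      smul_add, smul_smul, smul_eq_mul]
    congr 2 <;> ring

/-- The two-parameter family of devices: `z ∈ [0, 1]`, and `μ, ν ∈ ℝ` are constrained by imposing
the map to be trace preserving. -/
def optimalFamily (b : ONB d) : Set (Mat (Fin d) →ₗ[ℂ] Mat (Fin d × Fin d)) :=
  {T | ∃ z ∈ Set.Icc (0 : ℝ) 1, ∃ μ ν : ℝ, T = device b z μ ν ∧ IsTracePreserving T}

end InfoDisturbance

end

/-!
The proof compares an arbitrary device `T` with a device of the family that has *exactly* the
symmetrized first marginal of `T` and a POVM at least as sharp as that of `T`.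

Averaging the marginal `T₁` and the POVM `E'` of `T` over the diagonal unitaries and the
permutation matrices of the basis does not increase `Δ` and `δ`, by convexity and invariance
(`IsDisturbanceMeasure.exists_symmetric`, `IsErrorMeasure.exists_symmetric`). The averages can be
taken over finite groups, cube roots of unity being enough for the diagonal part (`sum_phases`).
The averaged marginal is determined by the numbers `x = ⟨k|Φ(|k⟩⟨k|)|k⟩` and
`y = ⟨k|Φ(|k⟩⟨l|)|l⟩` for `k ≠ l`, and the averaged POVM by the probability `r` of each wrong
outcome.

Let `I_i` be the operation of `T` for the outcome `i`. The matrices `A i` with entries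
`⟨k|I_i(|k⟩⟨l|)|l⟩` are positive semidefinite by complete positivity. The sum over `i` of their
traces is `d x`, that of the sums of all their entries is `d x + d (d - 1) y`, and that of their
diagonal entries away from `i` is a lower bound for `d (d - 1) r`. Minkowski's inequality for Gram
vectors and the intermediate value theorem give real amplitudes `u` and `g` such that the vectors
`(u, g, …, g)`, with `u` at position `i`, have the same two sums and no more weight away from `i`
(`exists_amplitudes`). Normalized, such a vector is the diagonal of a Kraus operator `K_i`, and its
squared norm is `d (1 - z)`. The device with these parameters has the averaged first marginal,
hence is trace preserving, and its probability of a wrong outcome is `g ^ 2 / d ≤ r`. Its POVM is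
thus a mixture of the averaged one and the target, so that its error is no larger
(`IsErrorMeasure.le_of_symmetric`).

Matrices are handled through their matrix elements in the basis `b` (`coord`). That members of the
family are channels follows from a Kraus decomposition (`isCompletelyPositive_device`).
-/

open scoped ComplexOrder Kronecker NNReal ENNReal

noncomputable section

namespace InfoDisturbance

/-! ### Averages in sublevel sets -/

theorem average_mem_of_convex {E ι : Type*} [AddCommMonoid E] [Module ℝ≥0 E] {S : Set E}
    (hS : Convex ℝ≥0 S) (x : ι → E) {t : Finset ι} (ht : t.Nonempty) (hx : ∀ i ∈ t, x i ∈ S) :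
    ((t.card : ℝ≥0)⁻¹) • ∑ i ∈ t, x i ∈ S := by
  induction ht using Finset.Nonempty.cons_induction with
  | singleton a => simpa using hx a
  | cons a t ha ht ih =>
    have h1 := ih fun i hi => hx i (Finset.mem_cons_of_mem hi)
    have h2 := hx a (Finset.mem_cons_self a t)
    have h0 : (t.card : ℝ≥0) ≠ 0 := by simpa using ht.ne_empty
    have h3 := hS h2 h1 (a := ((t.card : ℝ≥0) + 1)⁻¹) (b := ((t.card : ℝ≥0) + 1)⁻¹ * t.card)
      (by positivity) (by positivity) (by field_simp; ring)
    rw [smul_smul, mul_assoc, mul_inv_cancel₀ h0, mul_one, ← smul_add] at h3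
    rw [Finset.card_cons, Finset.sum_cons]
    exact_mod_cast h3

/-- Jensen's inequality for a finite family on which `f` is constant. It is derived from the
convexity of sublevel sets, as `ℝ≥0∞` is no module over a field. -/
theorem average_le_of_convexOn {E ι : Type*} [AddCommMonoid E] [Module ℝ≥0 E] {S : Set E}
    {f : E → ℝ≥0∞} (hf : ConvexOn ℝ≥0 S f) [Fintype ι] [Nonempty ι] (x : ι → E) (y : E)
    (hx : ∀ i, x i ∈ S) (hxy : ∀ i, f (x i) = f y) :
    ((Fintype.card ι : ℝ≥0)⁻¹) • ∑ i, x i ∈ S ∧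
      f (((Fintype.card ι : ℝ≥0)⁻¹) • ∑ i, x i) ≤ f y :=
  average_mem_of_convex (hf.convex_le (f y)) x Finset.univ_nonempty
    fun i _ => ⟨hx i, (hxy i).le⟩

/-! ### Coordinates with respect to an orthonormal basis -/

section Coordinates

variable {d : ℕ} (b : ONB d)

/-- The unitary matrix whose columns are the vectors of `b`. -/
def basisMat : Mat (Fin d) := Matrix.of fun p i => (b i).ofLp p

theorem basisMat_conjTranspose_mul : (basisMat b).conjTranspose * basisMat b = 1 := by
  ext i j
  have h := (orthonormal_iff_ite.mp b.orthonormal) i j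
  rw [EuclideanSpace.inner_eq_star_dotProduct] at h
  rw [Matrix.one_apply, ← h]
  simp [Matrix.mul_apply, basisMat, dotProduct, mul_comm]

theorem basisMat_mul_conjTranspose : basisMat b * (basisMat b).conjTranspose = 1 :=
  mul_eq_one_comm.mp (basisMat_conjTranspose_mul b)

/-- The matrix of `⟨i|M|j⟩` in the basis `b`. -/
def coord : Mat (Fin d) →ₗ[ℂ] Mat (Fin d) where
  toFun M := (basisMat b).conjTranspose * M * basisMat b
  map_add' x y := by rw [mul_add, add_mul]
  map_smul' c x := by simp

theorem coord_apply (M : Mat (Fin d)) :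
    coord b M = (basisMat b).conjTranspose * M * basisMat b := rfl

theorem coord_apply_apply (M : Mat (Fin d)) (i j : Fin d) :
    coord b M i j = ∑ p, ∑ q, star ((b i).ofLp p) * M p q * (b j).ofLp q := by
  simp only [coord_apply, Matrix.mul_apply, basisMat, Matrix.conjTranspose_apply, Matrix.of_apply,
    Finset.sum_mul]
  exact Finset.sum_comm

theorem coord_mul (M N : Mat (Fin d)) : coord b (M * N) = coord b M * coord b N := by
  simp only [coord_apply]
  calc _ = (basisMat b).conjTranspose * M * 1 * N * basisMat b := by simp [mul_assoc]
    _ = _ := by rw [← basisMat_mul_conjTranspose b]; simp only [mul_assoc]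

theorem coord_conjTranspose (M : Mat (Fin d)) :
    coord b M.conjTranspose = (coord b M).conjTranspose := by
  simp [coord_apply, mul_assoc]

@[simp] theorem coord_one : coord b 1 = 1 := by
  simp [coord_apply, basisMat_conjTranspose_mul]

theorem coord_injective : Function.Injective (coord b) := by
  intro M N h
  have key : ∀ M, basisMat b * coord b M * (basisMat b).conjTranspose = M := by
    intro M
    rw [coord_apply, mul_assoc, mul_assoc, mul_assoc, basisMat_mul_conjTranspose, mul_one,
      ← mul_assoc, basisMat_mul_conjTranspose, one_mul]
  rw [← key M, h, key N]

theorem trace_coord (M : Mat (Fin d)) : (coord b M).trace = M.trace := by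
  rw [coord_apply, Matrix.trace_mul_comm, ← mul_assoc, basisMat_mul_conjTranspose, one_mul]

theorem ketBra_eq (i j : Fin d) :
    ketBra b i j = basisMat b * Matrix.single i j 1 * (basisMat b).conjTranspose := by
  ext p q
  simp [ketBra, basisMat, Matrix.vecMulVec_apply, Matrix.mul_apply, Matrix.single_apply, ite_and]

@[simp] theorem coord_ketBra (i j : Fin d) : coord b (ketBra b i j) = Matrix.single i j 1 := by
  rw [ketBra_eq, coord_apply]
  calc _ = ((basisMat b).conjTranspose * basisMat b) * Matrix.single i j 1 *
        ((basisMat b).conjTranspose * basisMat b) := by simp only [mul_assoc]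
    _ = _ := by simp [basisMat_conjTranspose_mul]

theorem sum_coord_smul_ketBra (M : Mat (Fin d)) : ∑ i, ∑ j, coord b M i j • ketBra b i j = M := by
  apply coord_injective b
  simp only [map_sum, map_smul, coord_ketBra]
  conv_rhs => rw [Matrix.matrix_eq_sum_single (coord b M)]
  simp

theorem sum_ketBra : ∑ i, ketBra b i i = 1 := by
  apply coord_injective b
  ext k l
  simp [Matrix.sum_apply, Matrix.single_apply, Matrix.one_apply, ite_and]

theorem dotProduct_mulVec_basis (M : Mat (Fin d)) (i j : Fin d) :
    star (b i).ofLp ⬝ᵥ (M.mulVec (b j).ofLp) = coord b M i j := by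
  rw [coord_apply_apply]
  simp [dotProduct, Matrix.mulVec, Finset.mul_sum, mul_assoc]

theorem diagEntry_eq (i : Fin d) (M : Mat (Fin d)) : diagEntry b i M = coord b M i i :=
  dotProduct_mulVec_basis b M i i

theorem linearMap_ext_ketBra {E : Type*} [AddCommMonoid E] [Module ℂ E]
    {Φ Ψ : Mat (Fin d) →ₗ[ℂ] E} (h : ∀ k l, Φ (ketBra b k l) = Ψ (ketBra b k l)) : Φ = Ψ := by
  ext1 M
  rw [← sum_coord_smul_ketBra b M]
  simp only [map_sum, map_smul, h]

@[simp] theorem coord_permUnitary (π : Equiv.Perm (Fin d)) (k l : Fin d) :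
    coord b (permUnitary b π) k l = if k = π l then 1 else 0 := by
  simp only [permUnitary, map_sum, coord_ketBra, Matrix.sum_apply, Matrix.single_apply]
  rw [Finset.sum_eq_single l] <;> simp +contextual [eq_comm]

@[simp] theorem coord_diagonalIn (c : Fin d → ℂ) :
    coord b (diagonalIn b c) = Matrix.diagonal c := by
  ext k l
  simp [diagonalIn, Matrix.sum_apply, Matrix.single_apply, Matrix.diagonal_apply, ite_and]

theorem permUnitary_mem (π : Equiv.Perm (Fin d)) :
    permUnitary b π ∈ Matrix.unitaryGroup (Fin d) ℂ := by
  rw [Matrix.mem_unitaryGroup_iff', Matrix.star_eq_conjTranspose]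
  apply coord_injective b
  ext k l
  simp [coord_mul, coord_conjTranspose, Matrix.mul_apply, Matrix.one_apply, eq_comm]

theorem diagonalIn_mem {c : Fin d → ℂ} (hc : ∀ i, ‖c i‖ = 1) :
    diagonalIn b c ∈ Matrix.unitaryGroup (Fin d) ℂ := by
  rw [Matrix.mem_unitaryGroup_iff', Matrix.star_eq_conjTranspose]
  apply coord_injective b
  have h : ∀ i, (starRingEnd ℂ) (c i) * c i = 1 := fun i => by
    rw [← Complex.normSq_eq_conj_mul_self, Complex.normSq_eq_norm_sq, hc]; simp
  ext k l
  by_cases hkl : k = l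
  · subst hkl
    simp [coord_mul, coord_conjTranspose, Matrix.diagonal_conjTranspose, h]
  · simp [coord_mul, coord_conjTranspose, Matrix.diagonal_conjTranspose, hkl]

theorem coord_conj_permUnitary (π : Equiv.Perm (Fin d)) (M : Mat (Fin d)) (k l : Fin d) :
    coord b ((permUnitary b π).conjTranspose * M * permUnitary b π) k l
      = coord b M (π k) (π l) := by
  simp [coord_mul, coord_conjTranspose, Matrix.mul_apply, apply_ite]

theorem coord_conj_diagonalIn (c : Fin d → ℂ) (M : Mat (Fin d)) (k l : Fin d) :
    coord b ((diagonalIn b c).conjTranspose * M * diagonalIn b c) k l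
      = star (c k) * c l * coord b M k l := by
  simp [coord_mul, coord_conjTranspose, Matrix.diagonal_conjTranspose]
  ring

theorem permUnitary_conj_ketBra (π : Equiv.Perm (Fin d)) (k l : Fin d) :
    permUnitary b π * ketBra b k l * (permUnitary b π).conjTranspose = ketBra b (π k) (π l) := by
  apply coord_injective b
  ext m n
  simp only [coord_mul, coord_conjTranspose, coord_ketBra, Matrix.mul_apply, Matrix.single_apply,
    Matrix.conjTranspose_apply, coord_permUnitary]
  rw [Finset.sum_eq_single l _ (by simp), Finset.sum_eq_single k _ (by simp)]
  · by_cases h1 : m = π k <;> by_cases h2 : n = π l <;> simp [h1, h2, eq_comm]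
  · intro x _ hx; simp [hx.symm]
  · intro x _ hx; simp [hx.symm]

theorem diagonalIn_conj_ketBra (c : Fin d → ℂ) (k l : Fin d) :
    diagonalIn b c * ketBra b k l * (diagonalIn b c).conjTranspose
      = (c k * star (c l)) • ketBra b k l := by
  apply coord_injective b
  ext m n
  simp [coord_mul, coord_conjTranspose, Matrix.diagonal_conjTranspose, Matrix.single_apply]
  split_ifs with h <;> simp [h]

theorem coord_posSemidef {M : Mat (Fin d)} (h : M.PosSemidef) : (coord b M).PosSemidef :=
  h.conjTranspose_mul_mul_same _

end Coordinates

/-! ### Averages over phases and permutations -/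

/-- The finite group of diagonal unitaries used for averaging, as vectors of cube roots of unity.
A finite group makes plain convexity sufficient: the measures are not assumed continuous, so that
their values at Haar averages are not controlled directly. -/
abbrev Phases (d : ℕ) : Type := Fin d → rootsOfUnity 3 ℂ

instance (d : ℕ) : Fintype (Phases d) := Fintype.ofFinite _

/-- The `i`-th entry of `c` as a complex number. -/
def phase {d : ℕ} (c : Phases d) (i : Fin d) : ℂ := ((c i : ℂˣ) : ℂ)

theorem norm_phase {d : ℕ} (c : Phases d) (i : Fin d) : ‖phase c i‖ = 1 :=
  Complex.norm_eq_one_of_mem_rootsOfUnity (c i).2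

theorem star_phase {d : ℕ} (c : Phases d) (i : Fin d) : star (phase c i) = (phase c i)⁻¹ := by
  rw [Complex.inv_eq_conj (norm_phase c i)]; rfl

/-- A character `c ↦ c_a⁻¹ c_b c_k c_l⁻¹` averages to zero over the cube roots of unity unless it is
trivial for all phases: its exponents have modulus at most two, so a nonzero one is not divisible
by three. -/
theorem sum_phases {d : ℕ} (a b k l : Fin d) (h : ¬((a = b ∧ k = l) ∨ (a = k ∧ b = l))) :
    ∑ c : Phases d, star (phase c a) * phase c b * (phase c k * star (phase c l)) = 0 := by
  obtain ⟨w, hw⟩ : ∃ w : ℂˣ, IsPrimitiveRoot w 3 :=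
    ⟨_, (Complex.isPrimitiveRoot_exp 3 (by norm_num)).isUnit_unit (by norm_num)⟩
  have hw1 : (w : ℂ) ≠ 1 := by
    intro h; exact hw.ne_one (by norm_num) (Units.ext h)
  have hw2 : (w : ℂ) * w ≠ 1 := by
    intro h
    exact hw.pow_ne_one_of_pos_of_lt (l := 2) (by norm_num) (by norm_num)
      (Units.ext (by simpa [pow_two] using h))
  have hw0 : (w : ℂ) ≠ 0 := w.ne_zero
  let v : rootsOfUnity 3 ℂ := ⟨w, by simpa [mem_rootsOfUnity] using hw.pow_eq_one⟩
  let χ : Phases d →* ℂ :=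
    { toFun := fun c => star (phase c a) * phase c b * (phase c k * star (phase c l))
      map_one' := by simp [phase]
      map_mul' := fun x y => by
        simp only [phase, Pi.mul_apply, Subgroup.coe_mul, Units.val_mul, star_mul]
        ring }
  refine sum_hom_units_eq_zero χ fun hχ => ?_
  have key : ∀ j, χ (Pi.mulSingle j v) = 1 := fun j => by rw [hχ]; rfl
  have ph : ∀ j i : Fin d, phase (Pi.mulSingle j v) i = if i = j then (w : ℂ) else 1 := by
    intro j i
    by_cases hij : i = j
    · subst hij; simp [phase, v]
    · simp [phase, hij]
  simp only [χ, MonoidHom.coe_mk, OneHom.coe_mk, star_phase, ph] at key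
  -- In each case, an index at which the exponent is `1`, `-1` or `-2`.
  by_cases hab : a = b
  · have hkl : k ≠ l := fun e => h (Or.inl ⟨hab, e⟩)
    have := key k
    by_cases hb : b = k <;> simp_all [eq_comm]
  · by_cases hak : a = k
    · have hbl : b ≠ l := fun e => h (Or.inr ⟨hak, e⟩)
      have := key b
      subst hak
      simp_all [eq_comm]
    · have := key a
      by_cases hal : l = a
      · rw [if_pos rfl, if_neg (Ne.symm hab), if_neg (Ne.symm hak), if_pos hal, mul_one, one_mul,
          ← mul_inv, inv_eq_one] at this
        exact hw2 this
      · rw [if_pos rfl, if_neg (Ne.symm hab), if_neg (Ne.symm hak), if_neg hal, mul_one, one_mul,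
          inv_one, mul_one, inv_eq_one] at this
        exact hw1 this

theorem sum_perm_apply {d : ℕ} (f : Fin d → ℂ) (a : Fin d) :
    (d : ℂ) * ∑ π : Equiv.Perm (Fin d), f (π a)
      = (Fintype.card (Equiv.Perm (Fin d)) : ℂ) * ∑ i, f i := by
  have h : ∀ a', ∑ π : Equiv.Perm (Fin d), f (π a') = ∑ π : Equiv.Perm (Fin d), f (π a) := by
    intro a'
    refine Fintype.sum_equiv (Equiv.mulRight (Equiv.swap a a')) _ _ fun π => ?_
    simp
  have h2 : ∑ a' : Fin d, ∑ π : Equiv.Perm (Fin d), f (π a')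
      = d * ∑ π : Equiv.Perm (Fin d), f (π a) := by
    simp [h]
  rw [← h2, Finset.sum_comm]
  simp [fun π : Equiv.Perm (Fin d) => Equiv.sum_comp π f]

/-- The average over permutations of a function of two distinct indices, by double transitivity. -/
theorem sum_perm_apply_apply {d : ℕ} (f : Fin d → Fin d → ℂ) {a b : Fin d} (hab : a ≠ b) :
    (d * (d - 1) : ℂ) * ∑ π : Equiv.Perm (Fin d), f (π a) (π b)
      = (Fintype.card (Equiv.Perm (Fin d)) : ℂ) * ∑ i, ∑ j, if i = j then 0 else f i j := by
  set S := ∑ π : Equiv.Perm (Fin d), f (π a) (π b) with hS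
  have h : ∀ a' b', a' ≠ b' → ∑ π : Equiv.Perm (Fin d), f (π a') (π b') = S := by
    intro a' b' hab'
    obtain ⟨g, hg1, hg2⟩ := MulAction.is_two_pretransitive_iff.mp
      (Equiv.Perm.isMultiplyPretransitive (Fin d) 2) hab hab'
    refine Fintype.sum_equiv (Equiv.mulRight g) _ _ fun π => ?_
    simp only [Equiv.coe_mulRight, Equiv.Perm.mul_apply]
    rw [← hg1, ← hg2]; rfl
  have h2 : ∑ a', ∑ b', ∑ π : Equiv.Perm (Fin d), (if π a' = π b' then 0 else f (π a') (π b'))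
      = (d * (d - 1) : ℂ) * S := by
    have : ∀ a' b', ∑ π : Equiv.Perm (Fin d), (if π a' = π b' then 0 else f (π a') (π b'))
        = S - if a' = b' then S else 0 := by
      intro a' b'
      by_cases e : a' = b'
      · simp [e]
      · simp [e, h a' b' e]
    simp only [this, Finset.sum_sub_distrib, Finset.sum_ite_eq, Finset.mem_univ, if_true,
      Finset.sum_const, Finset.card_univ, Fintype.card_fin, nsmul_eq_mul]
    ring
  have h3 : ∀ π : Equiv.Perm (Fin d), ∑ a', ∑ b', (if π a' = π b' then 0 else f (π a') (π b'))
      = ∑ i, ∑ j, if i = j then 0 else f i j := by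
    intro π
    rw [← Equiv.sum_comp π fun i => ∑ j, if i = j then (0 : ℂ) else f i j]
    exact Finset.sum_congr rfl fun a' _ =>
      Equiv.sum_comp π fun j => if π a' = j then (0 : ℂ) else f (π a') j
  calc _ = ∑ a', ∑ π : Equiv.Perm (Fin d), ∑ b',
        (if π a' = π b' then 0 else f (π a') (π b')) := by
        rw [← h2]
        exact Finset.sum_congr rfl fun _ _ => Finset.sum_comm
    _ = ∑ π : Equiv.Perm (Fin d), ∑ a', ∑ b',
        (if π a' = π b' then 0 else f (π a') (π b')) := Finset.sum_comm
    _ = _ := by rw [Finset.sum_congr rfl fun π _ => h3 π]; simp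

/-! ### Completely positive maps -/

section CP

variable {ι κ κ' : Type}

theorem IsCompletelyPositive.add {Φ Ψ : Mat ι →ₗ[ℂ] Mat κ} (hΦ : IsCompletelyPositive Φ)
    (hΨ : IsCompletelyPositive Ψ) : IsCompletelyPositive (Φ + Ψ) :=
  fun n X hX => (hΦ n X hX).add (hΨ n X hX)

theorem isCompletelyPositive_zero : IsCompletelyPositive (0 : Mat ι →ₗ[ℂ] Mat κ) :=
  fun _ _ _ => Matrix.PosSemidef.zero

theorem isCompletelyPositive_sum {α : Type*} (s : Finset α) (Φ : α → Mat ι →ₗ[ℂ] Mat κ)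
    (h : ∀ i ∈ s, IsCompletelyPositive (Φ i)) : IsCompletelyPositive (∑ i ∈ s, Φ i) :=
  Finset.sum_induction _ _ (fun _ _ => IsCompletelyPositive.add) isCompletelyPositive_zero h

theorem IsCompletelyPositive.smul {Φ : Mat ι →ₗ[ℂ] Mat κ} (hΦ : IsCompletelyPositive Φ)
    {c : ℂ} (hc : 0 ≤ c) : IsCompletelyPositive (c • Φ) :=
  fun n X hX => (hΦ n X hX).smul hc

/-- The map `ρ ↦ Vᴴ ρ V` for a rectangular matrix `V`. -/
def compress [Fintype ι] (V : Matrix ι κ ℂ) : Mat ι →ₗ[ℂ] Mat κ where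
  toFun ρ := V.conjTranspose * ρ * V
  map_add' x y := by rw [Matrix.mul_add, Matrix.add_mul]
  map_smul' c x := by simp

theorem isCompletelyPositive_compress [Fintype ι] [Fintype κ] (V : Matrix ι κ ℂ) :
    IsCompletelyPositive (compress V) := by
  intro n X hX
  convert hX.conjTranspose_mul_mul_same ((1 : Matrix (Fin n) (Fin n) ℂ) ⊗ₖ V) using 1
  ext ⟨m, p⟩ ⟨m', q⟩
  simp [ampliation, compress, Matrix.mul_apply, Fintype.sum_prod_type, Matrix.one_apply,
    Finset.sum_ite_irrel, apply_ite]

theorem IsCompletelyPositive.comp {Φ : Mat ι →ₗ[ℂ] Mat κ} {Ψ : Mat κ →ₗ[ℂ] Mat κ'}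
    (hΨ : IsCompletelyPositive Ψ) (hΦ : IsCompletelyPositive Φ) :
    IsCompletelyPositive (Ψ ∘ₗ Φ) :=
  fun n X hX => hΨ n _ (hΦ n X hX)

/-- The compression by vectors `w k` of the Choi matrix of a completely positive map, formed with
vectors `u k`, is positive semidefinite. -/
theorem IsCompletelyPositive.posSemidef_blocks [Finite ι] [Fintype κ] {Φ : Mat ι →ₗ[ℂ] Mat κ}
    (hΦ : IsCompletelyPositive Φ) {n : ℕ} (u : Fin n → ι → ℂ) (w : Fin n → κ → ℂ) :
    (Matrix.of fun k l => star (w k) ⬝ᵥ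
      ((Φ (Matrix.vecMulVec (u k) (star (u l)))).mulVec (w l))).PosSemidef := by
  have h := hΦ n _ (Matrix.posSemidef_vecMulVec_self_star fun p : Fin n × ι => u p.1 p.2)
  convert h.conjTranspose_mul_mul_same
    (Matrix.of fun (p : Fin n × κ) k => if p.1 = k then w k p.2 else 0) using 1
  ext k l
  simp only [Matrix.mul_apply, Fintype.sum_prod_type, Matrix.conjTranspose_apply, Matrix.of_apply,
    apply_ite star, star_zero, ite_mul, zero_mul, mul_ite, mul_zero, ampliation, Finset.sum_mul,
    Finset.sum_ite_irrel, Finset.sum_const_zero]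
  simp only [Finset.sum_ite_eq', Finset.mem_univ, if_true]
  simp only [dotProduct, Matrix.mulVec, Finset.mul_sum, Pi.star_apply]
  rw [Finset.sum_comm]
  refine Finset.sum_congr rfl fun p _ => Finset.sum_congr rfl fun q _ => ?_
  rw [← mul_assoc]; rfl

theorem IsCompletelyPositive.posSemidef_apply {Φ : Mat ι →ₗ[ℂ] Mat κ}
    (hΦ : IsCompletelyPositive Φ) {M : Mat ι} (hM : M.PosSemidef) : (Φ M).PosSemidef :=
  (hΦ 1 (M.submatrix Prod.snd Prod.snd) (hM.submatrix _)).submatrix fun p => ((0 : Fin 1), p)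

end CP

/-! ### Instruments of measurement devices -/

section Instrument

variable {d : ℕ} (b : ONB d)

/-- The matrix `1 ⊗ |j⟩`. -/
def idKet (j : Fin d) : Matrix (Fin d × Fin d) (Fin d) ℂ :=
  Matrix.of fun p q => if p.1 = q then (b j).ofLp p.2 else 0

/-- The unnormalized state `(1 ⊗ ⟨j|) Y (1 ⊗ |j⟩)` of the first factor after outcome `j` has been
found on the second. -/
def outcome (j : Fin d) : Mat (Fin d × Fin d) →ₗ[ℂ] Mat (Fin d) := compress (idKet b j)

theorem outcome_apply (j : Fin d) (Y : Mat (Fin d × Fin d)) (p q : Fin d) :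
    outcome b j Y p q
      = ∑ s, ∑ t, star ((b j).ofLp s) * Y (p, s) (q, t) * (b j).ofLp t := by
  simp only [outcome, compress, idKet, LinearMap.coe_mk, AddHom.coe_mk, Matrix.mul_apply,
    Fintype.sum_prod_type, Matrix.conjTranspose_apply, Matrix.of_apply, apply_ite star, star_zero,
    ite_mul, zero_mul, mul_ite, mul_zero, Finset.sum_mul, Finset.sum_ite_irrel,
    Finset.sum_const_zero, Finset.sum_ite_eq', Finset.mem_univ, if_true]
  exact Finset.sum_comm

theorem sum_mul_star_basis (s t : Fin d) :
    ∑ j, (b j).ofLp t * star ((b j).ofLp s) = if t = s then 1 else 0 := by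
  have h := congrFun (congrFun (basisMat_mul_conjTranspose b) t) s
  simpa [Matrix.mul_apply, basisMat, Matrix.one_apply] using h

theorem sum_star_basis_mul (i j : Fin d) :
    ∑ s, star ((b i).ofLp s) * (b j).ofLp s = if i = j then 1 else 0 := by
  have h := congrFun (congrFun (basisMat_conjTranspose_mul b) i) j
  simpa [Matrix.mul_apply, basisMat, Matrix.one_apply] using h

theorem sum_outcome : ∑ j, outcome b j = traceSnd := by
  ext1 Y
  ext p q
  rw [LinearMap.sum_apply, Matrix.sum_apply]
  simp only [outcome_apply]
  rw [Finset.sum_comm]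
  simp only [traceSnd, LinearMap.coe_mk, AddHom.coe_mk, Matrix.of_apply]
  refine Finset.sum_congr rfl fun s _ => ?_
  rw [Finset.sum_comm]
  have : ∀ t, ∑ j, star ((b j).ofLp s) * Y (p, s) (q, t) * (b j).ofLp t
      = Y (p, s) (q, t) * if t = s then 1 else 0 := by
    intro t
    rw [← sum_mul_star_basis b, Finset.mul_sum]
    exact Finset.sum_congr rfl fun j _ => by ring
  rw [Finset.sum_congr rfl fun t _ => this t]
  simp

theorem trace_outcome (j : Fin d) (Y : Mat (Fin d × Fin d)) :
    (outcome b j Y).trace = (ketBra b j j * traceFst Y).trace := by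
  simp only [Matrix.trace, Matrix.diag_apply, outcome_apply, Matrix.mul_apply, ketBra,
    Matrix.vecMulVec_apply, traceFst, LinearMap.coe_mk, AddHom.coe_mk, Matrix.of_apply,
    Finset.mul_sum, Pi.star_apply]
  rw [Finset.sum_comm]
  rw [Finset.sum_congr rfl fun s _ => Finset.sum_comm]
  rw [Finset.sum_comm]
  refine Finset.sum_congr rfl fun t _ => Finset.sum_congr rfl fun s _ =>
    Finset.sum_congr rfl fun p _ => by ring

theorem outcome_kronecker (i j : Fin d) (A : Mat (Fin d)) :
    outcome b j (A ⊗ₖ ketBra b i i) = if i = j then A else 0 := by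
  ext p q
  rw [outcome_apply]
  have : ∑ s, ∑ t, star ((b j).ofLp s) * (A ⊗ₖ ketBra b i i) (p, s) (q, t) * (b j).ofLp t
      = A p q * (∑ s, star ((b j).ofLp s) * (b i).ofLp s) *
        ∑ t, star ((b i).ofLp t) * (b j).ofLp t := by
    simp only [Matrix.kroneckerMap_apply, ketBra, Matrix.vecMulVec_apply, Pi.star_apply,
      Finset.mul_sum, Finset.sum_mul]
    rw [Finset.sum_comm]
    exact Finset.sum_congr rfl fun s _ => Finset.sum_congr rfl fun t _ => by ring
  rw [this, sum_star_basis_mul, sum_star_basis_mul]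
  by_cases h : i = j <;> simp [h]

variable (T : Mat (Fin d) →ₗ[ℂ] Mat (Fin d × Fin d))

/-- The operation `I_j` performed by the device `T` when the outcome is `j`. -/
def instrument (j : Fin d) : Mat (Fin d) →ₗ[ℂ] Mat (Fin d) := outcome b j ∘ₗ T

theorem marginalFst_eq : marginalFst T = ∑ j, instrument b T j := by
  ext1 ρ
  simp [marginalFst, instrument, ← sum_outcome b]

theorem trace_measuredPOVM_mul (j : Fin d) (ρ : Mat (Fin d)) :
    (measuredPOVM b T j * ρ).trace = (instrument b T j ρ).trace := by
  rw [measuredPOVM, trace_dualMap_mul, instrument, LinearMap.comp_apply, trace_outcome]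
  rfl

theorem coord_measuredPOVM (j k l : Fin d) :
    coord b (measuredPOVM b T j) k l = (instrument b T j (ketBra b l k)).trace := by
  rw [← trace_measuredPOVM_mul, ← trace_coord b, coord_mul, coord_ketBra]
  simp [Matrix.trace, Matrix.mul_apply, Matrix.single_apply, ite_and]

theorem trace_traceSnd (Y : Mat (Fin d × Fin d)) : (traceSnd Y).trace = Y.trace := by
  simp [Matrix.trace, traceSnd, Fintype.sum_prod_type]

theorem isTracePreserving_iff_marginalFst :
    IsTracePreserving T ↔ IsTracePreserving (marginalFst T) := by
  simp [IsTracePreserving, marginalFst, trace_traceSnd]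

variable {T}

theorem isCompletelyPositive_instrument (hT : IsCompletelyPositive T) (j : Fin d) :
    IsCompletelyPositive (instrument b T j) :=
  (isCompletelyPositive_compress _).comp hT

theorem marginalFst_mem_channels (b : ONB d) (hT : T ∈ channels (Fin d) (Fin d × Fin d)) :
    marginalFst T ∈ channels (Fin d) (Fin d) :=
  ⟨marginalFst_eq b T ▸ isCompletelyPositive_sum _ _ fun j _ =>
    isCompletelyPositive_instrument b hT.1 j, (isTracePreserving_iff_marginalFst T).mp hT.2⟩

theorem measuredPOVM_mem_povms (hT : T ∈ channels (Fin d) (Fin d × Fin d)) :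
    measuredPOVM b T ∈ povms d := by
  constructor
  · intro j
    have hI := isCompletelyPositive_instrument b hT.1 j
    have h := Matrix.posSemidef_sum Finset.univ fun a _ =>
      hI.posSemidef_blocks (fun k : Fin d => Pi.single k 1) (fun _ => Pi.single a 1)
    refine (congrArg Matrix.PosSemidef (Matrix.ext fun k l => ?_)).mpr h.transpose
    have := trace_measuredPOVM_mul b T j (Matrix.single l k 1)
    rw [Matrix.transpose_apply, Matrix.sum_apply]
    have e : ∀ x : Fin d, star (Pi.single x (1 : ℂ) : Fin d → ℂ) = Pi.single x 1 := by
      intro x; ext y; by_cases h : y = x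
      · subst h; simp
      · simp [h]
    simpa [Matrix.trace, Matrix.mul_apply, Matrix.single_apply, ite_and, e,
      ← Matrix.single_eq_single_vecMulVec_single] using this
  · apply coord_injective b
    ext k l
    rw [map_sum, Matrix.sum_apply]
    simp only [coord_measuredPOVM]
    rw [← Matrix.trace_sum, ← LinearMap.sum_apply, ← marginalFst_eq,
      (isTracePreserving_iff_marginalFst T).mp hT.2, ← trace_coord b, coord_ketBra]
    by_cases h : k = l
    · subst h; simp
    · simp [h, Matrix.trace_single_eq_of_ne _ _ _ (Ne.symm h)]

end Instrument

/-! ### The devices of the optimal family -/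

section Device

variable {d : ℕ} (b : ONB d) (z μ ν : ℝ)

/-- The diagonal entries of `K_i` in the basis `b`. -/
def krausEntry (i a : Fin d) : ℂ := μ + if a = i then (ν : ℂ) else 0

theorem coord_krausOp (i : Fin d) :
    coord b (krausOp b μ ν i) = Matrix.diagonal (krausEntry μ ν i) := by
  ext a c
  by_cases h : a = c
  · subst h
    by_cases h' : a = i
    · simp [krausOp, krausEntry, h']
    · simp [krausOp, krausEntry, h', Ne.symm h']
  · have : ¬(i = a ∧ i = c) := fun e => h (e.1.symm.trans e.2)
    simp [krausOp, h, this]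

theorem instrument_device (j : Fin d) (ρ : Mat (Fin d)) :
    instrument b (device b z μ ν) j ρ
      = ((z : ℂ) * coord b ρ j j / ((d : ℂ) - 1)) • (1 - ketBra b j j)
        + (1 - (z : ℂ)) • (krausOp b μ ν j * ρ * krausOp b μ ν j) := by
  simp [instrument, device, outcome_kronecker, diagEntry_eq]

theorem coord_instrument_device (i k l a c : Fin d) :
    coord b (instrument b (device b z μ ν) i (ketBra b k l)) a c
      = (if k = i ∧ l = i then (z : ℂ) / ((d : ℂ) - 1) else 0)
          * ((if a = c then 1 else 0) - if a = i ∧ c = i then 1 else 0)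
        + (1 - (z : ℂ)) * (if a = k ∧ c = l then krausEntry μ ν i a * krausEntry μ ν i c else 0) := by
  rw [instrument_device]
  simp only [map_add, map_smul, map_sub, coord_one, coord_ketBra, coord_mul, coord_krausOp,
    Matrix.add_apply, Matrix.smul_apply, Matrix.sub_apply, smul_eq_mul, Matrix.one_apply,
    Matrix.single_apply, Matrix.mul_diagonal, Matrix.diagonal_mul, mul_ite, mul_zero, mul_one,
    ite_mul, zero_mul, ite_div, zero_div]
  congr 2
  · simp only [eq_comm]
  · simp only [eq_comm]

/-- The map `ρ ↦ B ρ Bᴴ ⊗ |i⟩⟨i|` has the single Kraus operator `B ⊗ |i⟩`. -/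
theorem compress_kronecker (B : Mat (Fin d)) (i : Fin d) (ρ : Mat (Fin d)) :
    compress (Matrix.of fun r (p : Fin d × Fin d) => star (B p.1 r * (b i).ofLp p.2)) ρ
      = (B * ρ * B.conjTranspose) ⊗ₖ ketBra b i i := by
  ext ⟨p, s⟩ ⟨q, t⟩
  simp only [compress, LinearMap.coe_mk, AddHom.coe_mk, Matrix.mul_apply,
    Matrix.conjTranspose_apply, Matrix.of_apply, star_star, Matrix.kroneckerMap_apply, ketBra,
    Matrix.vecMulVec_apply, Pi.star_apply, Finset.sum_mul, star_mul]
  exact Finset.sum_congr rfl fun x _ => Finset.sum_congr rfl fun y _ => by ring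

theorem krausOp_conjTranspose (i : Fin d) :
    (krausOp b μ ν i).conjTranspose = krausOp b μ ν i := by
  apply coord_injective b
  rw [coord_conjTranspose, coord_krausOp, Matrix.diagonal_conjTranspose]
  congr 1
  ext a
  by_cases h : a = i <;> simp [krausEntry, h]

theorem isCompletelyPositive_device (hd : 2 ≤ d) (hz : z ∈ Set.Icc (0 : ℝ) 1) :
    IsCompletelyPositive (device b z μ ν) := by
  have hd1 : (0 : ℝ) < d - 1 := by
    have : (2 : ℝ) ≤ d := by exact_mod_cast hd
    linarith
  let C (B : Mat (Fin d)) (i : Fin d) : Matrix (Fin d) (Fin d × Fin d) ℂ :=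
    Matrix.of fun r p => star (B p.1 r * (b i).ofLp p.2)
  have key : device b z μ ν = ∑ i, (((z / (d - 1) : ℝ) : ℂ) •
        ∑ j ∈ Finset.univ.erase i, compress (C (ketBra b j i) i)
      + ((1 - z : ℝ) : ℂ) • compress (C (krausOp b μ ν i) i)) := by
    ext1 ρ
    have hsum : ∀ i, ∑ j ∈ Finset.univ.erase i,
        ketBra b j i * ρ * (ketBra b j i).conjTranspose
          = coord b ρ i i • (1 - ketBra b i i) := by
      intro i
      rw [← sum_ketBra b, ← Finset.add_sum_erase _ _ (Finset.mem_univ i), add_sub_cancel_left,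
        Finset.smul_sum]
      refine Finset.sum_congr rfl fun j _ => coord_injective b ?_
      ext m n
      simp only [coord_mul, coord_conjTranspose, coord_ketBra, map_smul, Matrix.smul_apply,
        Matrix.conjTranspose_single, star_one, smul_eq_mul, Matrix.single_mul_mul_single,
        one_mul, mul_one]
      simp [Matrix.single_apply]
    simp only [LinearMap.sum_apply, LinearMap.add_apply, LinearMap.smul_apply, C,
      compress_kronecker, krausOp_conjTranspose]
    have hk : ∀ i, ∑ j ∈ Finset.univ.erase i,
        (ketBra b j i * ρ * (ketBra b j i).conjTranspose) ⊗ₖ ketBra b i i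
          = (coord b ρ i i • (1 - ketBra b i i)) ⊗ₖ ketBra b i i := by
      intro i
      rw [← hsum]
      ext p q
      simp only [Matrix.sum_apply, Matrix.kroneckerMap_apply, Finset.sum_mul]
    simp only [hk]
    simp only [device, LinearMap.coe_mk, AddHom.coe_mk, diagEntry_eq]
    refine Finset.sum_congr rfl fun i _ => ?_
    rw [← Matrix.smul_kronecker, ← Matrix.smul_kronecker, ← Matrix.add_kronecker, smul_smul]
    push_cast
    congr 3
    ring
  rw [key]
  refine isCompletelyPositive_sum _ _ fun i _ => IsCompletelyPositive.add ?_ ?_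
  · refine IsCompletelyPositive.smul (isCompletelyPositive_sum _ _ fun j _ =>
      isCompletelyPositive_compress _) ?_
    exact_mod_cast div_nonneg hz.1 hd1.le
  · refine (isCompletelyPositive_compress _).smul ?_
    exact_mod_cast sub_nonneg.mpr hz.2

theorem optimalFamily_subset_channels (hd : 2 ≤ d) :
    optimalFamily b ⊆ channels (Fin d) (Fin d × Fin d) := by
  rintro T ⟨z, hz, μ, ν, rfl, hT⟩
  exact ⟨isCompletelyPositive_device b z μ ν hd hz, hT⟩

theorem sum_krausEntry_mul_self (a : Fin d) :
    ∑ i, krausEntry μ ν i a * krausEntry μ ν i a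
      = ((μ + ν) ^ 2 + (d - 1) * μ ^ 2 : ℂ) := by
  have : ∀ i, krausEntry μ ν i a * krausEntry μ ν i a
      = (μ : ℂ) ^ 2 + if a = i then (μ + ν : ℂ) ^ 2 - (μ : ℂ) ^ 2 else 0 := by
    intro i; unfold krausEntry; split_ifs <;> ring
  simp [this, Finset.sum_add_distrib]
  ring

theorem sum_krausEntry_mul {a c : Fin d} (h : a ≠ c) :
    ∑ i, krausEntry μ ν i a * krausEntry μ ν i c
      = (2 * μ * (μ + ν) + (d - 2) * μ ^ 2 : ℂ) := by
  have : ∀ i, krausEntry μ ν i a * krausEntry μ ν i c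
      = (μ : ℂ) ^ 2 + (if a = i then (μ : ℂ) * ν else 0) + if c = i then (μ : ℂ) * ν else 0 := by
    intro i
    unfold krausEntry
    by_cases h1 : a = i
    · have h2 : c ≠ i := fun e => h (h1.trans e.symm)
      simp [h1, h2]; ring
    · simp only [h1, if_false]; split_ifs <;> ring
  simp [this, Finset.sum_add_distrib]
  ring

theorem coord_marginalFst_device (k l a c : Fin d) :
    coord b (marginalFst (device b z μ ν) (ketBra b k l)) a c
      = if a = k ∧ c = l then
          if a = c then (1 - z : ℂ) * ((μ + ν) ^ 2 + (d - 1) * μ ^ 2)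
          else (1 - z : ℂ) * (2 * μ * (μ + ν) + (d - 2) * μ ^ 2)
        else if a = c ∧ k = l then (z : ℂ) / (d - 1) else 0 := by
  rw [marginalFst_eq b, LinearMap.sum_apply, map_sum, Matrix.sum_apply]
  simp only [coord_instrument_device, Finset.sum_add_distrib, ← Finset.mul_sum]
  have h1 : ∑ i, (if k = i ∧ l = i then (z : ℂ) / ((d : ℂ) - 1) else 0)
          * ((if a = c then 1 else 0) - if a = i ∧ c = i then 1 else 0)
      = if k = l then (z : ℂ) / ((d : ℂ) - 1)
          * ((if a = c then 1 else 0) - if a = k ∧ c = k then 1 else 0) else 0 := by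
    rw [Finset.sum_eq_single k]
    · by_cases h : k = l
      · simp [h]
      · simp [h, Ne.symm h]
    · intro i _ hi; simp [Ne.symm hi]
    · simp
  rw [h1]
  by_cases h : a = k ∧ c = l
  · obtain ⟨rfl, rfl⟩ := h
    by_cases hac : a = c
    · subst hac; simp [sum_krausEntry_mul_self]
    · simp [hac, sum_krausEntry_mul μ ν hac]
  · simp only [h, if_false, Finset.sum_const_zero, mul_zero, add_zero]
    by_cases hkl : k = l
    · subst hkl
      simp [h]
    · simp [hkl]

theorem coord_measuredPOVM_device (hd : 2 ≤ d) (i a c : Fin d) :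
    coord b (measuredPOVM b (device b z μ ν) i) a c
      = if a = c then
          if a = i then (z + (1 - z) * (μ + ν) ^ 2 : ℂ) else ((1 - z) * μ ^ 2 : ℂ)
        else 0 := by
  have hd1 : (d : ℂ) - 1 ≠ 0 := by
    rw [sub_ne_zero]; exact_mod_cast (by omega : d ≠ 1)
  rw [coord_measuredPOVM, ← trace_coord b, Matrix.trace]
  simp only [Matrix.diag_apply, coord_instrument_device, Finset.sum_add_distrib,
    ← Finset.mul_sum, Finset.sum_sub_distrib]
  by_cases h : a = c
  · subst h
    by_cases hi : a = i
    · subst hi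
      simp [krausEntry]
      field_simp
    · simp [krausEntry, hi, pow_two]
  · have h1 : ¬(c = i ∧ a = i) := fun e => h (e.2.trans e.1.symm)
    have h2 : ∀ x, ¬(x = c ∧ x = a) := fun x e => h (e.2.symm.trans e.1)
    simp [h, h1, h2]

end Device

/-! ### Symmetrization -/

section Twirl

variable {d : ℕ} (b : ONB d)

theorem isCompletelyPositive_conjMap (A : Mat (Fin d)) : IsCompletelyPositive (conjMap A) := by
  have : conjMap A = compress A.conjTranspose := by
    ext1 ρ; simp [conjMap, compress]
  exact this ▸ isCompletelyPositive_compress _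

theorem isTracePreserving_conjMap {U : Mat (Fin d)} (hU : U ∈ Matrix.unitaryGroup (Fin d) ℂ) :
    IsTracePreserving (conjMap U) := by
  intro ρ
  rw [Matrix.mem_unitaryGroup_iff', Matrix.star_eq_conjTranspose] at hU
  change (U * ρ * U.conjTranspose).trace = _
  rw [Matrix.trace_mul_comm, ← mul_assoc, hU, one_mul]

/-- Averaging a channel over unitary conjugations does not increase the disturbance. -/
theorem IsDisturbanceMeasure.exists_average {Δ : (Mat (Fin d) →ₗ[ℂ] Mat (Fin d)) → ℝ≥0∞}
    (hΔ : IsDisturbanceMeasure Δ) {Φ : Mat (Fin d) →ₗ[ℂ] Mat (Fin d)}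
    (hΦ : Φ ∈ channels (Fin d) (Fin d)) {ι : Type} [Fintype ι] [Nonempty ι] (U : ι → Mat (Fin d))
    (hU : ∀ i, U i ∈ Matrix.unitaryGroup (Fin d) ℂ) :
    ∃ Ψ ∈ channels (Fin d) (Fin d), Δ Ψ ≤ Δ Φ ∧ ∀ M a c, coord b (Ψ M) a c
      = (Fintype.card ι : ℂ)⁻¹ * ∑ i, coord b
          ((U i).conjTranspose * Φ (U i * M * (U i).conjTranspose) * U i) a c := by
  have hU' : ∀ i, (U i).conjTranspose ∈ Matrix.unitaryGroup (Fin d) ℂ := fun i =>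
    Unitary.star_mem (hU i)
  obtain ⟨h1, h2⟩ := average_le_of_convexOn hΔ.convex
    (fun i => conjMap (U i).conjTranspose ∘ₗ Φ ∘ₗ conjMap (U i).conjTranspose.conjTranspose) Φ
    (fun i => ⟨(isCompletelyPositive_conjMap _).comp (hΦ.1.comp (isCompletelyPositive_conjMap _)),
      fun ρ => by
        simp only [LinearMap.comp_apply]
        rw [isTracePreserving_conjMap (hU' i), hΦ.2, Matrix.conjTranspose_conjTranspose,
          isTracePreserving_conjMap (hU i)]⟩)
    (fun i => hΔ.basis_independent _ (hU' i) Φ hΦ)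
  refine ⟨_, h1, h2, fun M a c => ?_⟩
  rw [LinearMap.smul_apply, LinearMap.map_smul_of_tower, LinearMap.sum_apply, map_sum,
    Matrix.smul_apply, Matrix.sum_apply, NNReal.smul_def, Complex.real_smul]
  simp [conjMap]

/-- Averaging over diagonal unitaries and permutations leaves a channel with three independent matrix
elements, without increasing the disturbance. -/
theorem IsDisturbanceMeasure.exists_symmetric (hd : 2 ≤ d)
    {Δ : (Mat (Fin d) →ₗ[ℂ] Mat (Fin d)) → ℝ≥0∞}
    (hΔ : IsDisturbanceMeasure Δ) {Φ : Mat (Fin d) →ₗ[ℂ] Mat (Fin d)}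
    (hΦ : Φ ∈ channels (Fin d) (Fin d)) :
    ∃ Ψ ∈ channels (Fin d) (Fin d), Δ Ψ ≤ Δ Φ ∧ ∃ x y p : ℂ,
      (d : ℂ) * x = ∑ k, coord b (Φ (ketBra b k k)) k k ∧
      (d * (d - 1) : ℂ) * y
        = ∑ k, ∑ l, (if k = l then 0 else coord b (Φ (ketBra b k l)) k l) ∧
      ∀ k l a c, coord b (Ψ (ketBra b k l)) a c
        = if a = k ∧ c = l then if a = c then x else y
          else if a = c ∧ k = l then p else 0 := by
  obtain ⟨Φ₁, hΦ₁, h₁, e₁⟩ := hΔ.exists_average b hΦ (fun c : Phases d => diagonalIn b (phase c))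
    fun c => diagonalIn_mem b (norm_phase c)
  obtain ⟨Φ₂, hΦ₂, h₂, e₂⟩ := hΔ.exists_average b hΦ₁ (permUnitary b) (permUnitary_mem b)
  have f₁ : ∀ k l a c, coord b (Φ₁ (ketBra b k l)) a c
      = if (a = c ∧ k = l) ∨ (a = k ∧ c = l) then coord b (Φ (ketBra b k l)) a c else 0 := by
    intro k l a c
    have : ∀ f : Phases d, coord b ((diagonalIn b (phase f)).conjTranspose *
          Φ (diagonalIn b (phase f) * ketBra b k l * (diagonalIn b (phase f)).conjTranspose) *
          diagonalIn b (phase f)) a c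
        = star (phase f a) * phase f c * (phase f k * star (phase f l)) *
          coord b (Φ (ketBra b k l)) a c := by
      intro f
      rw [coord_conj_diagonalIn, diagonalIn_conj_ketBra, map_smul, map_smul, Matrix.smul_apply,
        smul_eq_mul]
      ring
    rw [e₁, Finset.sum_congr rfl fun f _ => this f, ← Finset.sum_mul]
    split_ifs with h
    · have hs : ∀ (f : Phases d) i, star (phase f i) * phase f i = 1 := fun f i => by
        rw [star_phase, inv_mul_cancel₀ (by simp [phase])]
      have : ∀ f : Phases d,
          star (phase f a) * phase f c * (phase f k * star (phase f l)) = 1 := by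
        intro f
        rcases h with ⟨rfl, rfl⟩ | ⟨rfl, rfl⟩
        · rw [mul_comm (phase f k), hs, hs, one_mul]
        · rw [mul_mul_mul_comm, hs, mul_comm, mul_comm (phase f c), hs, one_mul]
      rw [Finset.sum_congr rfl fun f _ => this f, Finset.sum_const, Finset.card_univ, nsmul_eq_mul,
        mul_one, inv_mul_cancel_left₀ (by exact_mod_cast Fintype.card_ne_zero)]
    · rw [sum_phases _ _ _ _ h]; simp
  have f₂ : ∀ k l a c, coord b (Φ₂ (ketBra b k l)) a c
      = (Fintype.card (Equiv.Perm (Fin d)) : ℂ)⁻¹ * ∑ π : Equiv.Perm (Fin d),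
          if (a = c ∧ k = l) ∨ (a = k ∧ c = l) then
            coord b (Φ (ketBra b (π k) (π l))) (π a) (π c) else 0 := by
    intro k l a c
    rw [e₂]
    congr 1
    refine Finset.sum_congr rfl fun π _ => ?_
    rw [permUnitary_conj_ketBra, coord_conj_permUnitary, f₁]
    simp
  have hN : (Fintype.card (Equiv.Perm (Fin d)) : ℂ) ≠ 0 := by
    exact_mod_cast Fintype.card_ne_zero
  have hd0 : (d : ℂ) ≠ 0 := by exact_mod_cast (by omega : d ≠ 0)
  have hd1 : (d : ℂ) - 1 ≠ 0 := by
    rw [sub_ne_zero]; exact_mod_cast (by omega : d ≠ 1)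
  refine ⟨Φ₂, hΦ₂, h₂.trans h₁, (d : ℂ)⁻¹ * ∑ k, coord b (Φ (ketBra b k k)) k k,
    (d * (d - 1) : ℂ)⁻¹ * ∑ k, ∑ l, (if k = l then 0 else coord b (Φ (ketBra b k l)) k l),
    (d * (d - 1) : ℂ)⁻¹ * ∑ k, ∑ l, (if k = l then 0 else coord b (Φ (ketBra b l l)) k k),
    mul_inv_cancel_left₀ hd0 _, mul_inv_cancel_left₀ (mul_ne_zero hd0 hd1) _, fun k l a c => ?_⟩
  rw [f₂, inv_mul_eq_iff_eq_mul₀ hN]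
  by_cases h : a = k ∧ c = l
  · obtain ⟨rfl, rfl⟩ := h
    simp only [and_self, or_true, if_true]
    by_cases hac : a = c
    · subst hac
      simp only [if_true]
      rw [mul_left_comm, ← sum_perm_apply (fun i => coord b (Φ (ketBra b i i)) i i) a,
        inv_mul_cancel_left₀ hd0]
    · simp only [hac, if_false]
      rw [mul_left_comm,
        ← sum_perm_apply_apply (fun i j => coord b (Φ (ketBra b i j)) i j) hac,
        inv_mul_cancel_left₀ (mul_ne_zero hd0 hd1)]
  · simp only [h, or_false, if_false]
    by_cases h' : a = c ∧ k = l
    · obtain ⟨rfl, rfl⟩ := h'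
      have hak : a ≠ k := fun e => h ⟨e, e⟩
      simp only [and_self, if_true]
      rw [mul_left_comm,
        ← sum_perm_apply_apply (fun i j => coord b (Φ (ketBra b j j)) i i) hak,
        inv_mul_cancel_left₀ (mul_ne_zero hd0 hd1)]
    · simp [h']

variable {b}

theorem conj_mem_povms {M : Fin d → Mat (Fin d)} (hM : M ∈ povms d) {U : Mat (Fin d)}
    (hU : U ∈ Matrix.unitaryGroup (Fin d) ℂ) (π : Equiv.Perm (Fin d)) :
    (fun i => U.conjTranspose * M (π i) * U) ∈ povms d := by
  refine ⟨fun i => (hM.1 _).conjTranspose_mul_mul_same _, ?_⟩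
  rw [← Finset.sum_mul, ← Finset.mul_sum, Equiv.sum_comp π M, hM.2, mul_one]
  exact Matrix.mem_unitaryGroup_iff'.mp hU

/-- Averaging over diagonal unitaries and permutations makes all elements of a POVM diagonal, with
one entry for the target outcome and one for the others, without increasing the error. -/
theorem IsErrorMeasure.exists_symmetric (hd : 2 ≤ d) {δ : (Fin d → Mat (Fin d)) → ℝ≥0∞}
    (hδ : IsErrorMeasure b δ) {M : Fin d → Mat (Fin d)} (hM : M ∈ povms d) :
    ∃ N ∈ povms d, δ N ≤ δ M ∧ ∃ q r : ℂ,
      (d * (d - 1) : ℂ) * r = ∑ i, ∑ j, (if i = j then 0 else coord b (M i) j j) ∧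
      ∀ i a c, coord b (N i) a c = if a = c then if a = i then q else r else 0 := by
  obtain ⟨hM₁, h₁⟩ := average_le_of_convexOn hδ.convex
    (fun (f : Phases d) i =>
      (diagonalIn b (phase f)).conjTranspose * M i * diagonalIn b (phase f)) M
    (fun f => conj_mem_povms hM (diagonalIn_mem b (norm_phase f)) 1)
    (fun f => hδ.diagonal_invariant _ (norm_phase f) M hM)
  set M₁ := ((Fintype.card (Phases d) : ℝ≥0)⁻¹) • ∑ f : Phases d, fun i =>
      (diagonalIn b (phase f)).conjTranspose * M i * diagonalIn b (phase f) with hM₁def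
  obtain ⟨hM₂, h₂⟩ := average_le_of_convexOn hδ.convex
    (fun (π : Equiv.Perm (Fin d)) i => (permUnitary b π).conjTranspose * M₁ (π i) * permUnitary b π)
    M₁ (fun π => conj_mem_povms hM₁ (permUnitary_mem b π) π)
    (fun π => hδ.perm_invariant π M₁ hM₁)
  have f₁ : ∀ i a c, coord b (M₁ i) a c = if a = c then coord b (M i) a c else 0 := by
    intro i a c
    rw [hM₁def, Pi.smul_apply, LinearMap.map_smul_of_tower, Finset.sum_apply, map_sum,
      Matrix.smul_apply, Matrix.sum_apply, NNReal.smul_def, Complex.real_smul]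
    simp only [coord_conj_diagonalIn, ← Finset.sum_mul]
    split_ifs with h
    · subst h
      have hs : ∀ f : Phases d, star (phase f a) * phase f a = 1 := fun f => by
        rw [star_phase, inv_mul_cancel₀ (by simp [phase])]
      rw [Finset.sum_congr rfl fun f _ => hs f, Finset.sum_const, Finset.card_univ, nsmul_eq_mul,
        mul_one]
      push_cast
      rw [inv_mul_cancel_left₀ (by exact_mod_cast Fintype.card_ne_zero)]
    · have := sum_phases a c a a (by rintro (⟨e, _⟩ | ⟨_, e⟩) <;> simp_all)
      have hs : ∀ f : Phases d, phase f a * star (phase f a) = 1 := fun f => by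
        rw [star_phase, mul_inv_cancel₀ (by simp [phase])]
      simp only [hs, mul_one] at this
      rw [this]; simp
  have hN : (Fintype.card (Equiv.Perm (Fin d)) : ℂ) ≠ 0 := by
    exact_mod_cast Fintype.card_ne_zero
  have hd0 : (d : ℂ) ≠ 0 := by exact_mod_cast (by omega : d ≠ 0)
  have hd1 : (d : ℂ) - 1 ≠ 0 := by
    rw [sub_ne_zero]; exact_mod_cast (by omega : d ≠ 1)
  refine ⟨_, hM₂, h₂.trans h₁, (d : ℂ)⁻¹ * ∑ i, coord b (M i) i i,
    (d * (d - 1) : ℂ)⁻¹ * ∑ i, ∑ j, (if i = j then 0 else coord b (M i) j j),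
    mul_inv_cancel_left₀ (mul_ne_zero hd0 hd1) _, fun i a c => ?_⟩
  rw [Pi.smul_apply, LinearMap.map_smul_of_tower, Finset.sum_apply, map_sum,
    Matrix.smul_apply, Matrix.sum_apply, NNReal.smul_def, Complex.real_smul]
  simp only [coord_conj_permUnitary, f₁, (Equiv.injective _).eq_iff]
  push_cast
  rw [inv_mul_eq_iff_eq_mul₀ hN]
  by_cases h : a = c
  · subst h
    simp only [if_true]
    by_cases hi : a = i
    · subst hi
      simp only [if_true]
      rw [mul_left_comm, ← sum_perm_apply (fun i => coord b (M i) i i) a, inv_mul_cancel_left₀ hd0]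
    · simp only [hi, if_false]
      rw [mul_left_comm,
        ← sum_perm_apply_apply (fun i j => coord b (M i) j j) (Ne.symm hi),
        inv_mul_cancel_left₀ (mul_ne_zero hd0 hd1)]
  · simp [h]

end Twirl

/-! ### The parameters of the optimal device -/

/-- The vectors `(u, g, …, g)` with `n` entries `g` and squared norm `α + n γ`, where `g ^ 2 ≤ γ`:
the sum of the entries takes every value between those of `(√α, -√γ, …, -√γ)` and
`(√α, √γ, …, √γ)`. -/
theorem exists_sq_add_mul_sq_eq {n α γ s : ℝ} (hn : 0 ≤ n) (hα : 0 ≤ α) (hγ : 0 ≤ γ)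
    (h₁ : √α - n * √γ ≤ s) (h₂ : s ≤ √α + n * √γ) :
    ∃ u g : ℝ, u ^ 2 + n * g ^ 2 = α + n * γ ∧ u + n * g = s ∧ g ^ 2 ≤ γ := by
  have hle : -√γ ≤ √γ := by linarith [Real.sqrt_nonneg γ]
  have hc : ContinuousOn (fun g : ℝ => √(α + n * γ - n * g ^ 2) + n * g)
      (Set.Icc (-√γ) (√γ)) := by fun_prop
  have hmem := intermediate_value_Icc hle hc (show s ∈ _ by
    constructor
    · simpa [Real.sq_sqrt hγ, ← sub_eq_add_neg] using h₁
    · simpa [Real.sq_sqrt hγ] using h₂)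
  obtain ⟨g, ⟨hg1, hg2⟩, hg⟩ := hmem
  have hg3 : g ^ 2 ≤ γ := by
    rw [← Real.sq_sqrt hγ]; exact sq_le_sq' hg1 hg2
  refine ⟨√(α + n * γ - n * g ^ 2), g, ?_, hg, hg3⟩
  rw [Real.sq_sqrt (by nlinarith)]
  ring

open scoped MatrixOrder in
/-- Positive semidefinite matrices `A i` are matched by pure ones, with the vector that has entry `u`
at `i` and `g` elsewhere: the sum over `i` of the traces and that of the sums of all entries are
reproduced, and the weight of the diagonal entries away from `i` does not increase. The constraint
on the sum of the entries is Minkowski's inequality for Gram vectors of the `A i`, stacked over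
`i`. -/
theorem exists_amplitudes {d : ℕ} (hd : 2 ≤ d) (A : Fin d → Mat (Fin d))
    (hA : ∀ i, (A i).PosSemidef) :
    ∃ u g : ℝ, ((u ^ 2 + (d - 1) * g ^ 2 : ℝ) : ℂ) = ∑ i, ∑ k, A i k k ∧
      (((u + (d - 1) * g) ^ 2 : ℝ) : ℂ) = ∑ i, ∑ k, ∑ l, A i k l ∧
      (((d - 1) * g ^ 2 : ℝ) : ℂ) ≤ ∑ i, ∑ j, if i = j then 0 else A i j j := by
  have hd1 : (0 : ℝ) < d - 1 := by
    have : (2 : ℝ) ≤ d := by exact_mod_cast hd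
    linarith
  choose B hB using fun i => CStarAlgebra.nonneg_iff_eq_star_mul_self.mp (hA i).nonneg
  have hentry : ∀ i k l, A i k l = ∑ c, star (B i c k) * B i c l := fun i k l => by
    rw [hB i]; simp [Matrix.mul_apply, Matrix.star_apply]
  have hdiag : ∀ i k, A i k k = ((∑ c, ‖B i c k‖ ^ 2 : ℝ) : ℂ) := fun i k => by
    rw [hentry]; push_cast
    exact Finset.sum_congr rfl fun c _ => by
      rw [← Complex.conj_mul']; rfl
  have hsum : ∀ i, ∑ k, ∑ l, A i k l = ((∑ c, ‖∑ k, B i c k‖ ^ 2 : ℝ) : ℂ) := fun i => by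
    have : ∀ c, ((‖∑ k, B i c k‖ : ℝ) : ℂ) ^ 2 = ∑ k, ∑ l, star (B i c k) * B i c l := fun c => by
      rw [← Complex.conj_mul', map_sum, Finset.sum_mul_sum]; rfl
    push_cast
    simp only [this, hentry]
    rw [Finset.sum_congr rfl fun k _ => Finset.sum_comm, Finset.sum_comm]
  -- The stacked Gram vectors of the index `i` itself, and of all other indices together.
  let P : EuclideanSpace ℂ (Fin d × Fin d) := WithLp.toLp 2 fun e => B e.1 e.2 e.1
  let R : EuclideanSpace ℂ (Fin d × Fin d) :=
    WithLp.toLp 2 fun e => ∑ k ∈ Finset.univ.erase e.1, B e.1 e.2 k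
  set α : ℝ := ∑ i, ∑ c, ‖B i c i‖ ^ 2 with hα
  set β : ℝ := ∑ i, ∑ k ∈ Finset.univ.erase i, ∑ c, ‖B i c k‖ ^ 2 with hβ
  have hP : ‖P‖ = √α := by
    rw [EuclideanSpace.norm_eq, Fintype.sum_prod_type]
  have hPR : ‖P + R‖ ^ 2 = ∑ i, ∑ c, ‖∑ k, B i c k‖ ^ 2 := by
    rw [EuclideanSpace.norm_sq_eq, Fintype.sum_prod_type]
    refine Finset.sum_congr rfl fun i _ => Finset.sum_congr rfl fun c _ => ?_
    rw [← Finset.add_sum_erase _ _ (Finset.mem_univ i)]; rfl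
  have hβ0 : 0 ≤ β := Finset.sum_nonneg fun _ _ => Finset.sum_nonneg fun _ _ =>
    Finset.sum_nonneg fun _ _ => sq_nonneg _
  have hα0 : 0 ≤ α := Finset.sum_nonneg fun _ _ => Finset.sum_nonneg fun _ _ => sq_nonneg _
  clear_value α β
  -- Cauchy–Schwarz for the `d - 1` vectors whose sum is `R`.
  have hR : ‖R‖ ≤ (d - 1) * √(β / (d - 1)) := by
    have h1 : ‖R‖ ^ 2 ≤ (d - 1) * β := by
      rw [EuclideanSpace.norm_sq_eq, Fintype.sum_prod_type, hβ, Finset.mul_sum]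
      refine Finset.sum_le_sum fun i _ => ?_
      rw [Finset.sum_comm, Finset.mul_sum]
      refine Finset.sum_le_sum fun c _ => ?_
      calc ‖∑ k ∈ Finset.univ.erase i, B i c k‖ ^ 2
          ≤ (∑ k ∈ Finset.univ.erase i, ‖B i c k‖) ^ 2 := by gcongr; exact norm_sum_le _ _
        _ ≤ ((Finset.univ.erase i).card : ℝ) * ∑ k ∈ Finset.univ.erase i, ‖B i c k‖ ^ 2 :=
          sq_sum_le_card_mul_sum_sq
        _ = _ := by
          rw [Finset.card_erase_of_mem (Finset.mem_univ i), Finset.card_univ, Fintype.card_fin,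
            Nat.cast_sub (by omega), Nat.cast_one]
    refine (sq_le_sq₀ (norm_nonneg _) (mul_nonneg hd1.le (Real.sqrt_nonneg _))).mp ?_
    rw [mul_pow, Real.sq_sqrt (div_nonneg hβ0 hd1.le)]
    calc _ ≤ _ := h1
      _ = _ := by field_simp
  obtain ⟨u, g, h1, h2, h3⟩ := exists_sq_add_mul_sq_eq (n := (d : ℝ) - 1) (s := ‖P + R‖)
    hd1.le hα0 (div_nonneg hβ0 hd1.le)
    (by rw [← hP]; linarith [norm_sub_le_norm_add P R])
    (by rw [← hP]; linarith [norm_add_le P R])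
  refine ⟨u, g, ?_, ?_, ?_⟩
  · rw [h1, mul_div_cancel₀ _ hd1.ne']
    simp only [hdiag]
    rw [hα, hβ, ← Finset.sum_add_distrib]
    norm_cast
    refine Finset.sum_congr rfl fun i _ => ?_
    rw [Finset.add_sum_erase _ (fun k => ∑ c, ‖B i c k‖ ^ 2) (Finset.mem_univ i)]
  · rw [h2, hPR]
    simp only [hsum]
    norm_cast
  · have h4 : ∀ i, ∑ j, (if i = j then 0 else A i j j)
        = ((∑ k ∈ Finset.univ.erase i, ∑ c, ‖B i c k‖ ^ 2 : ℝ) : ℂ) := by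
      intro i
      rw [← Finset.add_sum_erase _ _ (Finset.mem_univ i), if_pos rfl, zero_add,
        Complex.ofReal_sum]
      refine Finset.sum_congr rfl fun j hj => ?_
      rw [if_neg (Finset.ne_of_mem_erase hj).symm, hdiag]
    simp only [h4]
    rw [← Complex.ofReal_sum, Complex.real_le_real, ← hβ]
    rwa [le_div_iff₀' hd1] at h3

/-! ### Optimality -/

section Optimality

variable {d : ℕ} (b : ONB d)

theorem sum_ite_eq_add_mul (hd : 1 ≤ d) (j : Fin d) (x y : ℂ) :
    ∑ i, (if i = j then x else y) = x + (d - 1) * y := by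
  rw [← Finset.add_sum_erase _ _ (Finset.mem_univ j), if_pos rfl,
    Finset.sum_congr rfl fun i hi => if_neg (Finset.ne_of_mem_erase hi), Finset.sum_const,
    Finset.card_erase_of_mem (Finset.mem_univ _), Finset.card_univ, Fintype.card_fin, nsmul_eq_mul,
    Nat.cast_sub hd, Nat.cast_one]

theorem sum_sum_off_diag (f : Fin d → Fin d → ℂ) :
    ∑ k, ∑ l, (if k = l then 0 else f k l) = ∑ k, ∑ l, f k l - ∑ k, f k k := by
  rw [← Finset.sum_sub_distrib]
  refine Finset.sum_congr rfl fun k _ => ?_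
  rw [← Finset.add_sum_erase _ _ (Finset.mem_univ k),
    ← Finset.add_sum_erase _ (f k) (Finset.mem_univ k), if_pos rfl, zero_add, add_sub_cancel_left]
  exact Finset.sum_congr rfl fun l hl => if_neg (Finset.ne_of_mem_erase hl).symm

/-- The vector `(u, g, …, g)` is its norm times the diagonal `(μ + ν, μ, …, μ)` of some `K_i` of unit
norm; if it vanishes, any `K_i` of unit norm will do. -/
theorem exists_kraus_parameters {d : ℕ} (hd : 2 ≤ d) (u g : ℝ) :
    ∃ μ ν : ℝ, (μ + ν) ^ 2 + (d - 1) * μ ^ 2 = 1 ∧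
      (u ^ 2 + (d - 1) * g ^ 2) * μ ^ 2 = g ^ 2 ∧
      (u ^ 2 + (d - 1) * g ^ 2) * (μ * (μ + ν)) = u * g := by
  have hd1 : (0 : ℝ) < d - 1 := by
    have : (2 : ℝ) ≤ d := by exact_mod_cast hd
    linarith
  have hX0 : 0 ≤ u ^ 2 + (d - 1) * g ^ 2 := by positivity
  rcases hX0.eq_or_lt with hX | hX
  · have hg : g = 0 := by
      have : (d - 1) * g ^ 2 = 0 := by nlinarith [sq_nonneg u, mul_nonneg hd1.le (sq_nonneg g)]
      simpa [hd1.ne'] using this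
    exact ⟨0, 1, by norm_num, by simp [hg], by simp [hg]⟩
  · set X := u ^ 2 + (d - 1) * g ^ 2 with hXdef
    have hs : √X ≠ 0 := (Real.sqrt_pos.mpr hX).ne'
    have hs2 : √X ^ 2 = X := Real.sq_sqrt hX.le
    refine ⟨g / √X, u / √X - g / √X, ?_, ?_, ?_⟩
    · rw [add_sub_cancel, div_pow, div_pow, hs2]
      field_simp
      exact hXdef.symm
    · rw [div_pow, hs2]; field_simp
    · rw [add_sub_cancel, div_mul_div_comm, ← pow_two, hs2, mul_div_cancel₀ _ hX.ne', mul_comm]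

variable {T : Mat (Fin d) →ₗ[ℂ] Mat (Fin d × Fin d)}

/-- The matrix of `⟨k|I_i(|k⟩⟨l|)|l⟩`, a compression of the Choi matrix of the operation `I_i`. -/
theorem coherence_posSemidef (hT : IsCompletelyPositive T) (i : Fin d) :
    (Matrix.of fun k l => coord b (instrument b T i (ketBra b k l)) k l).PosSemidef := by
  have h := (isCompletelyPositive_instrument b hT i).posSemidef_blocks
    (fun k => (b k).ofLp) (fun k => (b k).ofLp)
  simp only [dotProduct_mulVec_basis] at h
  exact h

/-- The probability of the outcome `i` on the state `|k⟩` is at least that of finding `i` and `|k⟩`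
again. -/
theorem coord_instrument_le_measuredPOVM (hT : IsCompletelyPositive T) (i k : Fin d) :
    coord b (instrument b T i (ketBra b k k)) k k ≤ coord b (measuredPOVM b T i) k k := by
  rw [coord_measuredPOVM, ← trace_coord b]
  have h : (coord b (instrument b T i (ketBra b k k))).PosSemidef :=
    coord_posSemidef b ((isCompletelyPositive_instrument b hT i).posSemidef_apply
      (Matrix.posSemidef_vecMulVec_self_star _))
  exact Finset.single_le_sum (f := fun a => coord b (instrument b T i (ketBra b k k)) a a)
    (fun a _ => h.diag_nonneg) (Finset.mem_univ k)

theorem ketBra_mem_povms : (fun i => ketBra b i i) ∈ povms d :=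
  ⟨fun _ => Matrix.posSemidef_vecMulVec_self_star _, sum_ketBra b⟩

/-- Sharpening: reducing the weight off the target outcome of a symmetric POVM does not increase
the error, since the result is a mixture with the target measurement. -/
theorem IsErrorMeasure.le_of_symmetric {b : ONB d} (hd : 2 ≤ d) {δ : (Fin d → Mat (Fin d)) → ℝ≥0∞}
    (hδ : IsErrorMeasure b δ) {N N' : Fin d → Mat (Fin d)} (hN : N ∈ povms d) {q r q' : ℂ}
    {r' : ℝ} (hr' : 0 ≤ r') (hr : (r' : ℂ) ≤ r) (hq' : q' + (d - 1) * r' = 1)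
    (e : ∀ i a c, coord b (N i) a c = if a = c then if a = i then q else r else 0)
    (e' : ∀ i a c, coord b (N' i) a c = if a = c then if a = i then q' else (r' : ℂ) else 0) :
    δ N' ≤ δ N := by
  have hq : q + (d - 1) * r = 1 := by
    have h := congrArg (fun M => coord b M ⟨0, by omega⟩ ⟨0, by omega⟩) hN.2
    simp only [map_sum, Matrix.sum_apply, e, coord_one, Matrix.one_apply_eq, if_true] at h
    simp only [eq_comm (a := (⟨0, by omega⟩ : Fin d))] at h
    rwa [sum_ite_eq_add_mul (by omega)] at h
  obtain ⟨s, rfl⟩ : ∃ s : ℝ, (s : ℂ) = r :=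
    ⟨r.re, by
      have := (Complex.le_def.mp hr).2
      exact Complex.ext rfl (by simpa using this)⟩
  rw [Complex.real_le_real] at hr
  -- For `s = 0` also `r' = 0`, and the quotient is `0 / 0 = 0`.
  have hls : r' / s * s = r' := by
    rcases eq_or_ne s 0 with hs | hs
    · simp [hs]; linarith
    · exact div_mul_cancel₀ _ hs
  have hl0 : 0 ≤ r' / s := div_nonneg hr' (hr'.trans hr)
  have hl1 : r' / s ≤ 1 := div_le_one_of_le₀ hr (hr'.trans hr)
  obtain ⟨t, ht⟩ : ∃ t : ℝ≥0, (t : ℝ) = r' / s := ⟨⟨_, hl0⟩, rfl⟩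
  obtain ⟨t', ht'⟩ : ∃ t' : ℝ≥0, (t' : ℝ) = 1 - r' / s := ⟨⟨_, sub_nonneg.mpr hl1⟩, rfl⟩
  have h := hδ.convex.convex_le (δ N) ⟨hN, le_rfl⟩
    ⟨ketBra_mem_povms b, by rw [hδ.target_eq_zero]; exact zero_le⟩
    (a := t) (b := t') zero_le zero_le
    (NNReal.eq (by rw [NNReal.coe_add, ht, ht', add_sub_cancel, NNReal.coe_one]))
  refine (congrArg δ (funext fun i => ?_)).trans_le h.2
  apply coord_injective b
  ext a c
  have hls' : ((r' / s : ℝ) : ℂ) * s = r' := by exact_mod_cast hls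
  rw [Pi.add_apply, Pi.smul_apply, Pi.smul_apply, map_add, LinearMap.map_smul_of_tower,
    LinearMap.map_smul_of_tower, Matrix.add_apply, Matrix.smul_apply, Matrix.smul_apply,
    NNReal.smul_def, NNReal.smul_def, Complex.real_smul, Complex.real_smul, ht, ht', e, e',
    coord_ketBra]
  by_cases hac : a = c
  · subst hac
    by_cases hi : a = i
    · subst hi
      simp only [if_true, Matrix.single_apply_same, Complex.ofReal_sub,
        Complex.ofReal_one]
      linear_combination hq' - ((r' / s : ℝ) : ℂ) * hq + ((d : ℂ) - 1) * hls'
    · simp [hi, Ne.symm hi, hls', -Complex.ofReal_div]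
  · have : ¬(i = a ∧ i = c) := fun e => hac (e.1.symm.trans e.2)
    simp [hac, this]

/-- A device of the optimal family whose first marginal is the symmetrization of that of `T`, and
whose POVM is at least as sharp as the symmetrized POVM of `T`. -/
theorem exists_device_le (hd : 2 ≤ d)
    {Δ : (Mat (Fin d) →ₗ[ℂ] Mat (Fin d)) → ℝ≥0∞} (hΔ : IsDisturbanceMeasure Δ)
    {δ : (Fin d → Mat (Fin d)) → ℝ≥0∞} (hδ : IsErrorMeasure b δ)
    (hT : T ∈ channels (Fin d) (Fin d × Fin d)) :
    ∃ T' ∈ optimalFamily b, Δ (marginalFst T') ≤ Δ (marginalFst T) ∧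
      δ (measuredPOVM b T') ≤ δ (measuredPOVM b T) := by
  have hdR : (2 : ℝ) ≤ d := by exact_mod_cast hd
  have hd0 : (d : ℂ) ≠ 0 := by exact_mod_cast (by omega : d ≠ 0)
  have hd1 : (d : ℂ) - 1 ≠ 0 := by
    rw [sub_ne_zero]; exact_mod_cast (by omega : d ≠ 1)
  obtain ⟨Φ, hΦ, hΔΦ, x, y, p, hx, hy, eΦ⟩ :=
    hΔ.exists_symmetric b hd (marginalFst_mem_channels b hT)
  obtain ⟨N, hN, hδN, q, r, hr, eN⟩ := hδ.exists_symmetric hd (measuredPOVM_mem_povms b hT)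
  obtain ⟨u, g, h1, h2, h3⟩ := exists_amplitudes hd
    (fun i => Matrix.of fun k l => coord b (instrument b T i (ketBra b k l)) k l)
    (coherence_posSemidef b hT.1)
  simp only [Matrix.of_apply] at h1 h2 h3
  obtain ⟨μ, ν, k1, k2, k3⟩ := exists_kraus_parameters hd u g
  set X : ℝ := u ^ 2 + (d - 1) * g ^ 2 with hX
  have hmarg : ∀ k l, coord b (marginalFst T (ketBra b k l)) k l
      = ∑ i, coord b (instrument b T i (ketBra b k l)) k l := fun k l => by
    rw [marginalFst_eq b, LinearMap.sum_apply, map_sum, Matrix.sum_apply]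
  -- The two free parameters of the symmetrized marginal are those of the device.
  have hxX : (d : ℂ) * x = X := by
    rw [hx, h1, Finset.sum_comm]; simp only [hmarg]
  have hyX : (d : ℂ) * y = 2 * (u * g) + (d - 2) * g ^ 2 := by
    have e : ∑ k, ∑ l, (if k = l then 0 else coord b (marginalFst T (ketBra b k l)) k l)
        = (((u + (d - 1) * g) ^ 2 : ℝ) : ℂ) - X := by
      rw [sum_sum_off_diag fun k l => coord b (marginalFst T (ketBra b k l)) k l, ← hx, hxX, h2]
      simp only [hmarg]
      rw [Finset.sum_congr rfl fun k _ => Finset.sum_comm, Finset.sum_comm]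
    rw [e, hX] at hy
    push_cast at hy
    apply mul_left_cancel₀ hd1
    linear_combination hy
  have hxp : x + (d - 1) * p = 1 := by
    have h := hΦ.2 (ketBra b ⟨0, by omega⟩ ⟨0, by omega⟩)
    rw [← trace_coord b, ← trace_coord b (ketBra b _ _), coord_ketBra,
      Matrix.trace_single_eq_same, Matrix.trace] at h
    simp only [Matrix.diag_apply, eΦ, and_self, if_true] at h
    rwa [sum_ite_eq_add_mul (by omega)] at h
  have hp : 0 ≤ p := by
    have h := (coord_posSemidef b (hΦ.1.posSemidef_apply
      (M := ketBra b ⟨0, by omega⟩ ⟨0, by omega⟩)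
      (Matrix.posSemidef_vecMulVec_self_star _))).diag_nonneg (i := ⟨1, by omega⟩)
    simpa [eΦ] using h
  have hx' : x = ((X / d : ℝ) : ℂ) := by
    push_cast; rw [← hxX, mul_div_cancel_left₀ _ hd0]
  have hX0 : 0 ≤ X := by
    have : (0 : ℝ) ≤ d - 1 := by linarith
    positivity
  have hz0 : 0 ≤ 1 - X / d := by
    have h : (0 : ℂ) ≤ ((1 - X / d : ℝ) : ℂ) := by
      rw [Complex.ofReal_sub, ← hx', Complex.ofReal_one, ← hxp, add_sub_cancel_left]
      refine mul_nonneg ?_ hp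
      have : (0 : ℝ) ≤ d - 1 := by linarith
      exact_mod_cast this
    exact_mod_cast h
  have k1' : ((μ + ν) ^ 2 + (d - 1) * μ ^ 2 : ℂ) = 1 := by exact_mod_cast k1
  have k2' : (X * μ ^ 2 : ℂ) = g ^ 2 := by exact_mod_cast k2
  have k3' : (X * (μ * (μ + ν)) : ℂ) = u * g := by exact_mod_cast k3
  have hz : (1 : ℂ) - ((1 - X / d : ℝ) : ℂ) = x := by rw [hx']; push_cast; ring
  have hmarg' : marginalFst (device b (1 - X / d) μ ν) = Φ := by
    refine linearMap_ext_ketBra b fun k l => coord_injective b ?_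
    ext a c
    rw [coord_marginalFst_device, eΦ, hz, k1', mul_one]
    have hy' : x * (2 * μ * (μ + ν) + (d - 2) * μ ^ 2) = y := by
      apply mul_left_cancel₀ hd0
      rw [hyX]
      linear_combination (2 * μ * (μ + ν) + (d - 2) * μ ^ 2 : ℂ) * hxX + 2 * k3' + (d - 2) * k2'
    have hp' : ((1 - X / d : ℝ) : ℂ) / (d - 1) = p := by
      rw [div_eq_iff hd1]
      linear_combination -hz - hxp
    rw [hy', hp']
  refine ⟨device b (1 - X / d) μ ν, ⟨_, ⟨hz0, ?_⟩, μ, ν, rfl, ?_⟩, ?_, ?_⟩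
  · have : 0 ≤ X / d := by positivity
    linarith
  · rw [isTracePreserving_iff_marginalFst, hmarg']
    exact hΦ.2
  · rw [hmarg']
    exact hΔΦ
  · refine le_trans (hδ.le_of_symmetric hd hN (r' := g ^ 2 / d)
      (q' := ((1 - X / d : ℝ) : ℂ) + x * (μ + ν) ^ 2) (by positivity) ?_ ?_ eN ?_) hδN
    · -- A wrong outcome `i` on `|j⟩` is at least as likely as its part that preserves `|j⟩`.
      have h4 : (((d - 1) * g ^ 2 : ℝ) : ℂ) ≤ d * (d - 1) * r := by
        rw [hr]
        refine h3.trans (Finset.sum_le_sum fun i _ => Finset.sum_le_sum fun j _ => ?_)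
        split_ifs
        · exact le_rfl
        · exact coord_instrument_le_measuredPOVM b hT.1 i j
      have h5 : (0 : ℂ) ≤ (((d * (d - 1))⁻¹ : ℝ) : ℂ) := by
        have : (0 : ℝ) ≤ d - 1 := by linarith
        have : (0 : ℝ) ≤ ((d : ℝ) * (d - 1))⁻¹ := by positivity
        exact_mod_cast this
      have h6 := mul_le_mul_of_nonneg_left h4 h5
      push_cast at h6 ⊢
      convert h6 using 1 <;> field_simp
    · push_cast
      rw [← k2', ← hxX, mul_assoc (d : ℂ), mul_div_cancel_left₀ _ hd0, mul_div_cancel_left₀ _ hd0]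
      linear_combination x * k1'
    · intro i a c
      rw [coord_measuredPOVM_device b _ _ _ hd, hz]
      have : x * (μ : ℂ) ^ 2 = ((g ^ 2 / d : ℝ) : ℂ) := by
        push_cast
        rw [← k2', ← hxX, mul_assoc (d : ℂ), mul_div_cancel_left₀ _ hd0]
      rw [this]

end Optimality

end InfoDisturbance

end

open InfoDisturbance in
theorem theorem4p1 (d : ℕ) (hd : 2 ≤ d) (b : ONB d)
    (Δ : (Mat (Fin d) →ₗ[ℂ] Mat (Fin d)) → ℝ≥0∞) (hΔ : IsDisturbanceMeasure Δ)
    (δ : (Fin d → Mat (Fin d)) → ℝ≥0∞) (hδ : IsErrorMeasure b δ) :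
    optimalFamily b ⊆ channels (Fin d) (Fin d × Fin d) ∧
    ∀ T ∈ channels (Fin d) (Fin d × Fin d), ∃ T' ∈ optimalFamily b,
      Δ (marginalFst T') ≤ Δ (marginalFst T) ∧
      δ (measuredPOVM b T') ≤ δ (measuredPOVM b T) := by
  exact ⟨optimalFamily_subset_channels b hd, fun T hT => exists_device_le b hd hΔ hδ hT⟩
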